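/- Theorem A.1 (Bootstrap CLT for triangular arrays). Let $(k_n)_{n\in\mathbb{N}}$ be positive integers with $k_n\to\infty$, and let $\{\xi_{n,i} : n\in\mathbb{N},\ 1\le i\le k_n\}$ be real random variables on a probability space $(\Omega,\mathcal{F},\mathsf{P})$ such that, for every $n$, the variables $\xi_{n,1},\dots,\xi_{n,k_n}$ are independent and identically distributed with mean zero (no assumption is made on the dependence between different rows). Put $\varsigma_n^2=\mathsf{Var}\,\xi_{n,1}$, $\varsigma_n=\sqrt{\varsigma_n^2}$, and suppose that $$\sup_{n\in\mathbb{N}}\mathsf{E}\,\xi_{n,1}^4<\infty\qquad\text{and}\qquad\liminf_{n\to\infty}\varsigma_n^2>0 .$$ For every $n$ let $(\xi_{n,1}^*,\dots,\xi_{n,k_n}^*)$ be a bootstrap version of $\boldsymbol\xi_n=(\xi_{n,1},\dots,\xi_{n,k_n})$, i.e. random variables on the same probability space obtained by resampling with replacement: conditionally on $\boldsymbol\xi_n$, they are independent and each is distributed according to the empirical distribution $k_n^{-1}\sum_{j=1}^{k_n}\delta_{\xi_{n,j}}$. Put $\bar\xi_n=k_n^{-1}\sum_{i=1}^{k_n}\xi_{n,i}$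 and $\bar\xi_n^*=k_n^{-1}\sum_{i=1}^{k_n}\xi_{n,i}^*$, and let $\mathsf{P}^*_{\boldsymbol\xi_n}$ denote the (regular) conditional probability given $\boldsymbol\xi_n$. Then $$\sup_{x\in\mathbb{R}}\left|\mathsf{P}^*_{\boldsymbol\xi_n}\!\left[\frac{\sqrt{k_n}}{\varsigma_n}\left(\bar\xi_n^*-\bar\xi_n\right)\le x\right]-\mathsf{P}\!\left[\frac{\sqrt{k_n}}{\varsigma_n}\,\bar\xi_n\le x\right]\right|\longrightarrow 0\quad\text{in }\mathsf{P}\text{-probability as }n\to\infty .$$ (The statistics need only be meaningful for large $n$, where $\varsigma_n>0$.) -/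

import Mathlib

open MeasureTheory ProbabilityTheory Filter Topology
open scoped ENNReal

noncomputable section

/-- The sample mean `k⁻¹ ∑ i, x i` of a sample of size `k`. -/
def sampleMean {k : ℕ} (x : Fin k → ℝ) : ℝ :=
  (k : ℝ)⁻¹ * ∑ i, x i

/-- The empirical distribution of a sample: mass `1 / k` at each of the observations
`x 0, …, x (k - 1)`, ties being counted with their multiplicity. -/
def empiricalLaw {k : ℕ} (x : Fin k → ℝ) : Measure ℝ :=
  (k : ℝ≥0∞)⁻¹ • ∑ j, Measure.dirac (x j)

/-- `ξs` is a bootstrap version of the sample `ξ` (resampling with replacement, same length):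
conditionally on `ξ`, the components of `ξs` are independent and each of them is uniformly
distributed on the observations, i.e. the conditional distribution of the vector `ξs` given the
vector `ξ` is the product of `k` copies of the empirical distribution of `ξ`. -/
structure IsBootstrapVersion {Ω : Type*} [MeasurableSpace Ω] (P : Measure Ω) [IsFiniteMeasure P]
    {k : ℕ} (ξ ξs : Fin k → Ω → ℝ) : Prop where
  measurable : ∀ i, Measurable (ξs i)
  condDistrib_eq : ∀ᵐ ω ∂P,
    condDistrib (fun ω' i => ξs i ω') (fun ω' i => ξ i ω') P (fun i => ξ i ω) =
      Measure.pi fun _ : Fin k => empiricalLaw fun j => ξ j ω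

/-- The Kolmogorov distance `sup_x |μ (-∞, x] - ν (-∞, x]|` of two laws on the real line. -/
def kolmogorovDist (μ ν : Measure ℝ) : ℝ :=
  ⨆ x : ℝ, |μ.real (Set.Iic x) - ν.real (Set.Iic x)|

/-- The standardized mean `√k · ξ̄ / √v` as a random variable. -/
def standardizedMean {Ω : Type*} {k : ℕ} (ξ : Fin k → Ω → ℝ) (v : ℝ) (ω : Ω) : ℝ :=
  √(k : ℝ) / √v * sampleMean fun i => ξ i ω

/-- The standardized bootstrap mean `√k · (ξ̄* - ξ̄) / √v` as a random variable. -/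
def standardizedBootstrapMean {Ω : Type*} {k : ℕ} (ξ ξs : Fin k → Ω → ℝ) (v : ℝ) (ω : Ω) : ℝ :=
  √(k : ℝ) / √v * ((sampleMean fun i => ξs i ω) - sampleMean fun i => ξ i ω)

end

/-! Both laws are compared with the standard normal law, and the triangle inequality for the
Kolmogorov distance concludes. What makes this work is a central limit theorem that is uniform over
the summand distribution (`exists_kolmogorovDist_gaussianReal_le`): its hypotheses are numerical
smallness conditions on 1/k, on the variance error and on the Lyapunov ratio. It therefore applies
sample by sample to the random empirical law, just as to the law of the row itself, with no passage
to almost surely convergent subsequences.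

Given the sample, the bootstrap mean is a standardized mean of independent draws from the empirical
law. The smallness conditions then hold as soon as `sampleFluctuation` lies below a threshold that
depends only on ε and on a lower bound for the variances. Fourth moments bound the expectation of
that fluctuation by a constant times 1/√k, so by Markov's inequality the exceptional event has
vanishing probability. Independence is used within rows only, since each n is treated separately. -/

/-! ### Quantitative expansion of characteristic functions -/

lemma norm_exp_ofReal_mul_I_sub_taylor_le (x : ℝ) :
    ‖Complex.exp (x * Complex.I) - (1 + x * Complex.I - (x : ℂ) ^ 2 / 2)‖ ≤ 4 * |x| ^ 3 := by
  have hn : ‖(x : ℂ) * Complex.I‖ = |x| := by simp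
  -- For |x| ≤ 1 the exponential remainder gives the factor e < 4; for |x| > 1 the crude bound 2 +
  -- |x| + x²/2 is at most (7/2)|x|³.
  rcases le_or_gt |x| 1 with h | h
  · have h1 := Complex.norm_exp_sub_sum_le_norm_mul_exp (x * Complex.I) 3
    have h2 : (∑ m ∈ Finset.range 3, ((x : ℂ) * Complex.I) ^ m / m.factorial) =
        1 + x * Complex.I - (x : ℂ) ^ 2 / 2 := by
      simp [Finset.sum_range_succ, Nat.factorial, mul_pow, Complex.I_sq]
      ring
    rw [h2, hn] at h1
    have h3 : Real.exp |x| ≤ 4 := by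
      have := Real.exp_le_exp.2 h
      have := Real.exp_one_lt_d9
      linarith
    nlinarith [pow_nonneg (abs_nonneg x) 3]
  · have h1 : ‖Complex.exp (x * Complex.I) - (1 + x * Complex.I - (x : ℂ) ^ 2 / 2)‖ ≤
        1 + (1 + |x| + |x| ^ 2 / 2) := by
      refine (norm_sub_le _ _).trans (add_le_add (by rw [Complex.norm_exp_ofReal_mul_I]) ?_)
      refine (norm_sub_le _ _).trans (add_le_add ((norm_add_le _ _).trans ?_) ?_)
      · rw [hn]; simp
      · simp
    have h2 : |x| ^ 2 ≤ |x| ^ 3 := pow_le_pow_right₀ h.le (by norm_num)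
    nlinarith [h2]

lemma abs_exp_neg_sub_one_add_le {u : ℝ} (hu : 0 ≤ u) : |Real.exp (-u) - (1 - u)| ≤ u ^ 2 := by
  rcases le_or_gt u 1 with h | h
  · have := Real.norm_exp_sub_one_sub_id_le (x := -u) (by rw [norm_neg, Real.norm_of_nonneg hu]; exact h)
    rw [norm_neg, Real.norm_of_nonneg hu, Real.norm_eq_abs] at this
    convert this using 2
    ring
  · have h1 : Real.exp (-u) ≤ 1 := Real.exp_le_one_iff.2 (by linarith)
    have h2 := Real.exp_pos (-u)
    rw [abs_le]
    constructor <;> nlinarith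

lemma norm_pow_sub_pow_le_mul {R : Type*} [SeminormedCommRing R] [NormOneClass R] {a b : R} (ha : ‖a‖ ≤ 1)
    (hb : ‖b‖ ≤ 1) (n : ℕ) : ‖a ^ n - b ^ n‖ ≤ n * ‖a - b‖ := by
  induction n with
  | zero => simp
  | succ n ih =>
    have : a ^ (n + 1) - b ^ (n + 1) = a ^ n * (a - b) + (a ^ n - b ^ n) * b := by ring
    rw [this]
    have h1 : ‖a ^ n * (a - b)‖ ≤ 1 * ‖a - b‖ := (norm_mul_le _ _).trans
      (mul_le_mul_of_nonneg_right ((norm_pow_le _ _).trans (pow_le_one₀ (norm_nonneg _) ha))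
        (norm_nonneg _))
    have h2 : ‖(a ^ n - b ^ n) * b‖ ≤ (n * ‖a - b‖) * 1 := (norm_mul_le _ _).trans
      (mul_le_mul ih hb (norm_nonneg _) (by positivity))
    refine (norm_add_le _ _).trans ?_
    push_cast
    linarith

lemma integrable_pow_of_abs_cube {μ : Measure ℝ} [IsFiniteMeasure μ]
    (h3 : Integrable (fun x => |x| ^ 3) μ) {p : ℕ} (hp : p ≤ 3) :
    Integrable (fun x => x ^ p) μ := by
  refine ((integrable_const (1 : ℝ)).add h3).mono' (by fun_prop) (.of_forall fun x => ?_)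
  rw [norm_pow, Real.norm_eq_abs, Pi.add_apply]
  rcases le_or_gt |x| 1 with h | h
  · have := pow_le_one₀ (n := p) (abs_nonneg x) h
    have := pow_nonneg (abs_nonneg x) 3
    linarith
  · have := pow_le_pow_right₀ h.le hp
    linarith

/-- The pointwise Taylor bound is integrated; centering removes the linear term. -/
lemma norm_charFun_sub_le {μ : Measure ℝ} [IsProbabilityMeasure μ]
    (h3 : Integrable (fun x => |x| ^ 3) μ) (h1 : ∫ x, x ∂μ = 0) (s : ℝ) :
    ‖charFun μ s - (1 - (s : ℂ) ^ 2 / 2 * (∫ x, x ^ 2 ∂μ : ℝ))‖ ≤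
      4 * |s| ^ 3 * ∫ x, |x| ^ 3 ∂μ := by
  have i1 : Integrable (fun x : ℝ => x) μ := by
    simpa using integrable_pow_of_abs_cube h3 (p := 1) (by norm_num)
  have i2 := integrable_pow_of_abs_cube h3 (p := 2) (by norm_num)
  have iexp : Integrable (fun x : ℝ => Complex.exp (s * x * Complex.I)) μ := by
    refine (integrable_const (1 : ℝ)).mono' (by fun_prop) (.of_forall fun x => ?_)
    rw [← Complex.ofReal_mul, Complex.norm_exp_ofReal_mul_I]
  have j1 : Integrable (fun x : ℝ => (s : ℂ) * x * Complex.I) μ := (i1.ofReal.const_mul _).mul_const _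
  have j2 : Integrable (fun x : ℝ => ((s : ℂ) ^ 2 / 2) * ((x ^ 2 : ℝ) : ℂ)) μ := i2.ofReal.const_mul _
  have key : charFun μ s - (1 - (s : ℂ) ^ 2 / 2 * (∫ x, x ^ 2 ∂μ : ℝ)) =
      ∫ x : ℝ, (Complex.exp (s * x * Complex.I) -
        (1 + s * x * Complex.I - ((s : ℂ) ^ 2 / 2) * ((x ^ 2 : ℝ) : ℂ))) ∂μ := by
    have j0 : Integrable (fun x : ℝ => 1 + (s : ℂ) * x * Complex.I) μ :=
      (integrable_const (1 : ℂ)).add j1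
    have j3 : Integrable (fun x : ℝ => 1 + (s : ℂ) * x * Complex.I -
        ((s : ℂ) ^ 2 / 2) * ((x ^ 2 : ℝ) : ℂ)) μ := j0.sub j2
    rw [integral_sub iexp j3, integral_sub j0 j2, integral_add (integrable_const _) j1,
      integral_mul_const, integral_const_mul, integral_const_mul, integral_complex_ofReal,
      integral_complex_ofReal, h1, charFun_apply_real]
    simp
  rw [key, ← integral_const_mul]
  refine norm_integral_le_of_norm_le (h3.const_mul _) (.of_forall fun x => ?_)
  have := norm_exp_ofReal_mul_I_sub_taylor_le (s * x)
  rw [abs_mul, mul_pow, ← mul_assoc] at this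
  have e : ((s * x : ℝ) : ℂ) ^ 2 / 2 = (s : ℂ) ^ 2 / 2 * ((x ^ 2 : ℝ) : ℂ) := by push_cast; ring
  rw [e, Complex.ofReal_mul] at this
  exact this

/-- With s = t/√k, the Gaussian factor is itself the k-th power of exp(-s²/2), so the error is at
most k times the error of a single factor. The three terms come from the Taylor remainder, the
variance mismatch, and replacing 1 - s²/2 by exp(-s²/2). -/
lemma norm_charFun_pow_sub_le {μ : Measure ℝ} [IsProbabilityMeasure μ]
    (h3 : Integrable (fun x => |x| ^ 3) μ) (h1 : ∫ x, x ∂μ = 0) {k : ℕ} (hk : 0 < k) (t : ℝ) :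
    ‖charFun μ ((√(k : ℝ))⁻¹ * t) ^ k - Complex.exp (-(t : ℂ) ^ 2 / 2)‖ ≤
      4 * |t| ^ 3 * ((√(k : ℝ))⁻¹ * ∫ x, |x| ^ 3 ∂μ) + t ^ 2 / 2 * |(∫ x, x ^ 2 ∂μ) - 1| +
        t ^ 4 / 4 * (k : ℝ)⁻¹ := by
  have hk' : (0 : ℝ) < k := by exact_mod_cast hk
  set r := √(k : ℝ) with hr
  have hr0 : 0 < r := Real.sqrt_pos.2 hk'
  have hrk : r ^ 2 = k := Real.sq_sqrt hk'.le
  set s : ℝ := r⁻¹ * t with hs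
  have hs2 : k * s ^ 2 = t ^ 2 := by rw [hs, ← hrk]; field_simp
  have e1 : Complex.exp (-(t : ℂ) ^ 2 / 2) = ((Real.exp (-(s ^ 2 / 2)) : ℝ) : ℂ) ^ k := by
    have : Real.exp (-(s ^ 2 / 2)) ^ k = Real.exp (-t ^ 2 / 2) := by
      rw [← Real.exp_nat_mul, ← hs2]; ring_nf
    rw [← Complex.ofReal_pow (Real.exp _), this]
    push_cast
    rfl
  have hle : ‖((Real.exp (-(s ^ 2 / 2)) : ℝ) : ℂ)‖ ≤ 1 := by
    rw [Complex.norm_real, Real.norm_of_nonneg (Real.exp_pos _).le]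
    exact Real.exp_le_one_iff.2 (by nlinarith [sq_nonneg s])
  rw [e1]
  refine (norm_pow_sub_pow_le_mul (norm_charFun_le_one _) hle k).trans ?_
  have b1 := norm_charFun_sub_le h3 h1 s
  have b2 : ‖(1 - (s : ℂ) ^ 2 / 2 * (∫ x, x ^ 2 ∂μ : ℝ)) - (1 - (s : ℂ) ^ 2 / 2)‖ =
      s ^ 2 / 2 * |(∫ x, x ^ 2 ∂μ) - 1| := by
    have : (1 - (s : ℂ) ^ 2 / 2 * (∫ x, x ^ 2 ∂μ : ℝ)) - (1 - (s : ℂ) ^ 2 / 2) =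
      ((-(s ^ 2 / 2 * ((∫ x, x ^ 2 ∂μ) - 1)) : ℝ) : ℂ) := by push_cast; ring
    rw [this, Complex.norm_real, norm_neg, norm_mul, Real.norm_of_nonneg (by positivity),
      Real.norm_eq_abs]
  have b3 : ‖(1 - (s : ℂ) ^ 2 / 2) - ((Real.exp (-(s ^ 2 / 2)) : ℝ) : ℂ)‖ ≤ (s ^ 2 / 2) ^ 2 := by
    have : (1 - (s : ℂ) ^ 2 / 2) - ((Real.exp (-(s ^ 2 / 2)) : ℝ) : ℂ) =
      (((1 - s ^ 2 / 2) - Real.exp (-(s ^ 2 / 2)) : ℝ) : ℂ) := by push_cast; ring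
    rw [this, Complex.norm_real, norm_sub_rev, Real.norm_eq_abs]
    exact abs_exp_neg_sub_one_add_le (by positivity)
  have b : ‖charFun μ s - ((Real.exp (-(s ^ 2 / 2)) : ℝ) : ℂ)‖ ≤
      4 * |s| ^ 3 * (∫ x, |x| ^ 3 ∂μ) + s ^ 2 / 2 * |(∫ x, x ^ 2 ∂μ) - 1| + (s ^ 2 / 2) ^ 2 := by
    refine (norm_sub_le_norm_sub_add_norm_sub _
      (1 - (s : ℂ) ^ 2 / 2) _).trans (add_le_add ?_ b3)
    exact (norm_sub_le_norm_sub_add_norm_sub _ _ _).trans (add_le_add b1 b2.le)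
  refine (mul_le_mul_of_nonneg_left b hk'.le).trans (le_of_eq ?_)
  have c1 : k * |s| ^ 3 = |t| ^ 3 * r⁻¹ := by
    rw [hs, ← hrk, abs_mul, abs_of_pos (inv_pos.2 hr0)]; field_simp
  have c2 : k * (s ^ 2 / 2) ^ 2 = t ^ 4 / 4 * (k : ℝ)⁻¹ := by
    have : t ^ 4 = (k * s ^ 2) ^ 2 := by rw [hs2]; ring
    rw [this]; field_simp; ring
  calc _ = 4 * (k * |s| ^ 3) * (∫ x, |x| ^ 3 ∂μ) + (k * s ^ 2) / 2 * |(∫ x, x ^ 2 ∂μ) - 1|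
        + k * (s ^ 2 / 2) ^ 2 := by ring
    _ = _ := by rw [c1, hs2, c2]; ring
-- Kolmogorov distance and Pólya's theorem
lemma bddAbove_range_abs_sub_measureReal_Iic (μ ν : Measure ℝ) [IsProbabilityMeasure μ]
    [IsProbabilityMeasure ν] :
    BddAbove (Set.range fun x : ℝ => |μ.real (Set.Iic x) - ν.real (Set.Iic x)|) := by
  refine ⟨1, ?_⟩
  rintro _ ⟨x, rfl⟩
  have h1 : μ.real (Set.Iic x) ≤ 1 := measureReal_le_one
  have h2 : ν.real (Set.Iic x) ≤ 1 := measureReal_le_one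
  have h3 : 0 ≤ μ.real (Set.Iic x) := measureReal_nonneg
  have h4 : 0 ≤ ν.real (Set.Iic x) := measureReal_nonneg
  exact abs_le.2 ⟨by linarith, by linarith⟩

lemma kolmogorovDist_nonneg (μ ν : Measure ℝ) : 0 ≤ kolmogorovDist μ ν :=
  Real.iSup_nonneg fun _ => abs_nonneg _

lemma kolmogorovDist_comm (μ ν : Measure ℝ) : kolmogorovDist μ ν = kolmogorovDist ν μ := by
  simp only [kolmogorovDist, abs_sub_comm]

lemma kolmogorovDist_triangle (μ ν ρ : Measure ℝ) [IsProbabilityMeasure μ]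
    [IsProbabilityMeasure ν] [IsProbabilityMeasure ρ] :
    kolmogorovDist μ ρ ≤ kolmogorovDist μ ν + kolmogorovDist ν ρ :=
  ciSup_le fun x => (abs_sub_le _ (ν.real (Set.Iic x)) _).trans
    (add_le_add (le_ciSup (bddAbove_range_abs_sub_measureReal_Iic μ ν) x)
      (le_ciSup (bddAbove_range_abs_sub_measureReal_Iic ν ρ) x))

/-- The jump of the distribution function at a point is the mass of that point. -/
lemma continuous_cdf (ν : Measure ℝ) [IsProbabilityMeasure ν] [NullSingletonClass ν] :
    Continuous (cdf ν) := by
  refine continuous_iff_continuousAt.2 fun x => ?_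
  rw [(monotone_cdf ν).continuousAt_iff_leftLim_eq_rightLim, StieltjesFunction.rightLim_eq]
  have h := StieltjesFunction.measure_singleton (cdf ν) x
  rw [measure_cdf, measure_singleton] at h
  have h1 := ENNReal.ofReal_eq_zero.1 h.symm
  exact le_antisymm ((monotone_cdf ν).leftLim_le le_rfl) (by linarith)

lemma exists_cdf_eq (ν : Measure ℝ) [IsProbabilityMeasure ν] [NullSingletonClass ν] {p : ℝ} (h0 : 0 < p)
    (h1 : p < 1) : ∃ x, cdf ν x = p := by
  obtain ⟨a, ha⟩ := ((tendsto_cdf_atBot ν).eventually_lt_const h0).exists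
  obtain ⟨b, hb⟩ := ((tendsto_cdf_atTop ν).eventually_const_lt h1).exists
  exact mem_range_of_exists_le_of_exists_ge (continuous_cdf ν) ⟨a, ha.le⟩ ⟨b, hb.le⟩

/-- **Pólya's theorem**: convergence of distribution functions to a continuous distribution
function is uniform. -/
lemma tendsto_kolmogorovDist_of_tendsto_cdf {μ : ℕ → Measure ℝ} {ν : Measure ℝ}
    [∀ n, IsProbabilityMeasure (μ n)] [IsProbabilityMeasure ν] [NullSingletonClass ν]
    (h : ∀ x, Tendsto (fun n => cdf (μ n) x) atTop (𝓝 (cdf ν x))) :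
    Tendsto (fun n => kolmogorovDist (μ n) ν) atTop (𝓝 0) := by
  rw [Metric.tendsto_atTop']
  intro ε hε
  obtain ⟨N, hN⟩ := exists_nat_gt (4 / ε)
  have hN0 : (0 : ℝ) < N := lt_trans (by positivity) hN
  have hNε : 4 / (N : ℝ) < ε := by rw [div_lt_iff₀ hN0]; rw [div_lt_iff₀ hε] at hN; linarith
  -- A finite grid of quantiles: pointwise convergence is uniform on it, and monotonicity controls
  -- the gaps. Outside 1 ≤ j < N the point is irrelevant and set to 0.
  have hq : ∀ j : ℕ, ∃ x, 1 ≤ j → j < N → cdf ν x = j / N := by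
    intro j
    by_cases hj : 1 ≤ j ∧ j < N
    · have h1 : (0 : ℝ) < j := by exact_mod_cast hj.1
      have h2 : (j : ℝ) < N := by exact_mod_cast hj.2
      obtain ⟨x, hx⟩ := exists_cdf_eq ν (div_pos h1 hN0) ((div_lt_one hN0).2 h2)
      exact ⟨x, fun _ _ => hx⟩
    · exact ⟨0, fun a b => absurd ⟨a, b⟩ hj⟩
  choose q hq using hq
  have hev : ∀ᶠ n in atTop, ∀ j ∈ Finset.range N, |cdf (μ n) (q j) - cdf ν (q j)| < 1 / N := by
    refine (Finset.eventually_all _).2 fun j _ => ?_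
    exact Metric.tendsto_nhds.1 (h (q j)) (1 / N) (by positivity)
  obtain ⟨n₀, hn₀⟩ := eventually_atTop.1 hev
  refine ⟨n₀, fun n hn => ?_⟩
  have hn := hn₀ n hn.le
  rw [Real.dist_eq, sub_zero, abs_of_nonneg (kolmogorovDist_nonneg _ _)]
  refine lt_of_le_of_lt (ciSup_le fun x => ?_) hNε
  rw [← cdf_eq_real, ← cdf_eq_real]
  set F := cdf ν x with hF
  have hF0 : 0 ≤ F := cdf_nonneg ν x
  have hF1 : F ≤ 1 := cdf_le_one ν x
  have hG0 := cdf_nonneg (μ n) x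
  have hG1 := cdf_le_one (μ n) x
  have hpos : 0 < 1 / (N : ℝ) := by positivity
  have h4 : 4 / (N : ℝ) = 4 * (1 / N) := by ring
  have lower : F - 4 / N ≤ cdf (μ n) x := by
    rcases le_or_gt F (2 / N) with hle | hgt
    · have : 2 / (N : ℝ) = 2 * (1 / N) := by ring
      linarith
    -- Subtracting 1 makes j/N < F strict even when NF is an integer, which forces q j ≤ x. The cost
    -- is 2/N, plus 1/N from the convergence at q j.
    · set j := ⌊(N : ℝ) * F⌋₊ - 1 with hj
      have hNF : 2 < N * F := by rw [div_lt_iff₀ hN0] at hgt; linarith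
      have h2 : 2 ≤ ⌊(N : ℝ) * F⌋₊ := Nat.le_floor (by exact_mod_cast hNF.le)
      have hfl := Nat.floor_le (show (0 : ℝ) ≤ N * F by positivity)
      have hfl' := Nat.lt_floor_add_one ((N : ℝ) * F)
      have hjc : (j : ℝ) = ⌊(N : ℝ) * F⌋₊ - 1 := by
        rw [hj, Nat.cast_sub (by omega)]; simp
      have hjN : (j : ℝ) < N := by nlinarith
      have hjN' : j < N := by exact_mod_cast hjN
      have hqj := hq j (by omega) hjN'
      have hlt : (j : ℝ) / N < F := by rw [div_lt_iff₀ hN0]; linarith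
      have hge : F ≤ j / N + 2 * (1 / N) := by
        have : F = (N * F) / N := by field_simp
        rw [this]
        have : (j : ℝ) / N + 2 * (1 / N) = (j + 2) / N := by ring
        rw [this]
        gcongr
        linarith
      have hqx : q j ≤ x := by
        by_contra hcon
        have := monotone_cdf ν (not_le.1 hcon).le
        rw [hqj] at this
        linarith
      have m1 := monotone_cdf (μ n) hqx
      have m2 := (abs_lt.1 (hn j (Finset.mem_range.2 hjN'))).1
      rw [hqj] at m2
      linarith
  have upper : cdf (μ n) x ≤ F + 4 / N := by
    set j := ⌊(N : ℝ) * F⌋₊ + 1 with hj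
    have hfl := Nat.floor_le (show (0 : ℝ) ≤ N * F by positivity)
    have hfl' := Nat.lt_floor_add_one ((N : ℝ) * F)
    have hjc : (j : ℝ) = ⌊(N : ℝ) * F⌋₊ + 1 := by rw [hj]; push_cast; ring
    have hle : (j : ℝ) / N ≤ F + 1 / N := by
      have : F + 1 / (N : ℝ) = (N * F + 1) / N := by field_simp
      rw [this]
      gcongr
      linarith
    -- If j ≥ N there is no quantile to the right, but then F + 1/N ≥ 1 and the bound is trivial.
    rcases lt_or_ge j N with hjN | hjN
    · have hqj := hq j (by omega) hjN
      have hlt : F < (j : ℝ) / N := by rw [lt_div_iff₀ hN0]; linarith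
      have hqx : x ≤ q j := by
        by_contra hcon
        have := monotone_cdf ν (not_le.1 hcon).le
        rw [hqj] at this
        linarith
      have m1 := monotone_cdf (μ n) hqx
      have m2 := (abs_lt.1 (hn j (Finset.mem_range.2 hjN))).2
      rw [hqj] at m2
      linarith
    · have : (1 : ℝ) ≤ j / N := by rw [le_div_iff₀ hN0]; rw [one_mul]; exact_mod_cast hjN
      linarith
  exact abs_le.2 ⟨by linarith, by linarith⟩

lemma tendsto_kolmogorovDist_of_tendsto {μ : ℕ → ProbabilityMeasure ℝ} {ν : ProbabilityMeasure ℝ}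
    [NullSingletonClass (ν : Measure ℝ)] (h : Tendsto μ atTop (𝓝 ν)) :
    Tendsto (fun n => kolmogorovDist (μ n) ν) atTop (𝓝 0) := by
  refine tendsto_kolmogorovDist_of_tendsto_cdf fun x => ?_
  simp only [cdf_eq_real]
  refine (ENNReal.tendsto_toReal (measure_ne_top _ _)).comp
    (ProbabilityMeasure.tendsto_measure_of_null_frontier_of_tendsto' h ?_)
  rw [frontier_Iic, measure_singleton]

/-- A central limit theorem that is uniform over the summands: the Kolmogorov distance between the
law of a normalized sum and the standard normal law is small as soon as the number of summands is
large, the variance of the summands is close to one, and their Lyapunov ratio is small. -/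
lemma exists_kolmogorovDist_gaussianReal_le {ε : ℝ} (hε : 0 < ε) :
    ∃ δ > 0, ∀ (k : ℕ) (μ ν : Measure ℝ) [IsProbabilityMeasure μ] [IsProbabilityMeasure ν],
      0 < k → (k : ℝ)⁻¹ ≤ δ → (∀ t, charFun ν t = charFun μ ((√(k : ℝ))⁻¹ * t) ^ k) →
      ∫ x, x ∂μ = 0 → Integrable (fun x => |x| ^ 3) μ → |(∫ x, x ^ 2 ∂μ) - 1| ≤ δ →
      (√(k : ℝ))⁻¹ * ∫ x, |x| ^ 3 ∂μ ≤ δ → kolmogorovDist ν (gaussianReal 0 1) ≤ ε := by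
  -- Counterexamples for δ = 1/(n+1) would have characteristic functions converging to the Gaussian
  -- one, since every error term is O(1/(n+1)) for fixed t. Lévy's continuity theorem and Pólya's
  -- theorem then contradict their distance exceeding ε.
  by_contra! hcon
  have hδ : ∀ n : ℕ, (0 : ℝ) < 1 / ((n : ℝ) + 1) := fun n => Nat.one_div_pos_of_nat
  choose k μ ν hμ hν hk hkδ hchar hmean hint hvar hthird hdist using fun n : ℕ => hcon _ (hδ n)
  have hlim : Tendsto (fun n : ℕ => 1 / ((n : ℝ) + 1)) atTop (𝓝 0) :=
    tendsto_one_div_add_atTop_nhds_zero_nat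
  let ν' : ℕ → ProbabilityMeasure ℝ := fun n => ⟨ν n, hν n⟩
  let γ : ProbabilityMeasure ℝ := ⟨gaussianReal 0 1, inferInstance⟩
  have : NullSingletonClass (γ : Measure ℝ) := nullSingletonClass_gaussianReal one_ne_zero
  have hconv : Tendsto ν' atTop (𝓝 γ) := by
    refine ProbabilityMeasure.tendsto_iff_tendsto_charFun.2 fun t => ?_
    change Tendsto (fun n => charFun (ν n) t) atTop (𝓝 (charFun (gaussianReal 0 1) t))
    have hg : charFun (gaussianReal 0 1) t = Complex.exp (-(t : ℂ) ^ 2 / 2) := by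
      rw [charFun_gaussianReal]
      simp [neg_div]
    rw [hg, tendsto_iff_norm_sub_tendsto_zero]
    have hb : Tendsto (fun n : ℕ => (4 * |t| ^ 3 + t ^ 2 / 2 + t ^ 4 / 4) * (1 / ((n : ℝ) + 1)))
        atTop (𝓝 0) := by simpa using hlim.const_mul (4 * |t| ^ 3 + t ^ 2 / 2 + t ^ 4 / 4)
    refine squeeze_zero (fun _ => norm_nonneg _) (fun n => ?_) hb
    have := hμ n
    rw [hchar n t]
    refine (norm_charFun_pow_sub_le (hint n) (hmean n) (hk n) t).trans ?_
    rw [add_mul, add_mul]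
    gcongr
    exacts [hthird n, hvar n, hkδ n]
  obtain ⟨n, hn⟩ := ((tendsto_kolmogorovDist_of_tendsto hconv).eventually_lt_const hε).exists
  exact lt_asymm hn (hdist n)

/-! ### Freezing the conditioning variable -/

/-- Given X, the first argument of f may be treated as a constant. The candidate kernel
disintegrates the joint law of X and f(X, Y), so almost sure uniqueness of conditional distributions
identifies it. -/
lemma condDistrib_comp_prodMk_ae_eq {α β Ω Ω' : Type*} {mα : MeasurableSpace α} {mβ : MeasurableSpace β}
    [MeasurableSpace Ω] [StandardBorelSpace Ω] [Nonempty Ω]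
    [MeasurableSpace Ω'] [StandardBorelSpace Ω'] [Nonempty Ω']
    {μ : Measure α} [IsFiniteMeasure μ] {X : α → β} {Y : α → Ω} (hX : Measurable X)
    (hY : Measurable Y) {f : β → Ω → Ω'} (hf : Measurable (Function.uncurry f)) :
    ∀ᵐ a ∂μ, condDistrib (fun a => f (X a) (Y a)) X μ (X a) =
      (condDistrib Y X μ (X a)).map (f (X a)) := by
  -- The map `f b` varies with b; carrying b along through `Kernel.id` makes the fibrewise image a
  -- kernel by construction.
  set κ : Kernel β Ω' := (Kernel.id ×ₖ condDistrib Y X μ).map (Function.uncurry f) with hκ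
  have hκm : IsMarkovKernel κ := Kernel.IsMarkovKernel.map _ hf
  have happ : ∀ b, κ b = (condDistrib Y X μ b).map (f b) := fun b => by
    rw [hκ, Kernel.map_apply _ hf, Kernel.prod_apply, Kernel.id_apply, Measure.dirac_prod,
      Measure.map_map hf measurable_prodMk_left]
    rfl
  have hg : Measurable fun p : β × Ω => (p.1, f p.1 p.2) := measurable_fst.prodMk hf
  have h : condDistrib (fun a => f (X a) (Y a)) X μ =ᵐ[μ.map X] κ := by
    refine condDistrib_ae_eq_of_measure_eq_compProd X (hf.comp (hX.prodMk hY)).aemeasurable ?_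
    have e : μ.map (fun a => (X a, f (X a) (Y a))) =
        (μ.map X ⊗ₘ condDistrib Y X μ).map fun p => (p.1, f p.1 p.2) := by
      rw [compProd_map_condDistrib hY.aemeasurable, Measure.map_map hg (hX.prodMk hY)]
      rfl
    refine e.trans ?_
    ext s hs
    rw [Measure.map_apply hg hs, Measure.compProd_apply (hg hs), Measure.compProd_apply hs]
    refine lintegral_congr fun b => ?_
    have hfb : Measurable (f b) := hf.comp measurable_prodMk_left
    rw [happ, Measure.map_apply hfb (measurable_prodMk_left hs)]
    rfl
  filter_upwards [ae_of_ae_map hX.aemeasurable h] with a ha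
  rw [ha, happ]

/-! ### Central limit theorem for standardized sample means -/

@[fun_prop]
lemma measurable_sampleMean {k : ℕ} : Measurable (sampleMean : (Fin k → ℝ) → ℝ) := by
  unfold sampleMean
  fun_prop

lemma charFun_map_standardized_sampleMean {Ω : Type*} [MeasurableSpace Ω] {P : Measure Ω}
    [IsProbabilityMeasure P] {k : ℕ} (hk : 0 < k) {X : Fin k → Ω → ℝ} (hX : ∀ i, Measurable (X i))
    (hindep : iIndepFun X P) {ρ : Measure ℝ} (hρ : ∀ i, P.map (X i) = ρ) (v m t : ℝ) :
    charFun (P.map fun ω => √(k : ℝ) / √v * (sampleMean (fun i => X i ω) - m)) t =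
      charFun (ρ.map fun x => (x - m) / √v) ((√(k : ℝ))⁻¹ * t) ^ k := by
  have hk' : (0 : ℝ) < k := by exact_mod_cast hk
  have hr : √(k : ℝ) ^ 2 = k := Real.sq_sqrt hk'.le
  have hr0 : 0 < √(k : ℝ) := Real.sqrt_pos.2 hk'
  have hf : Measurable fun x : ℝ => (x - m) / √v := by fun_prop
  have e : (fun ω => √(k : ℝ) / √v * (sampleMean (fun i => X i ω) - m)) =
      fun ω => (√(k : ℝ))⁻¹ * ∑ i, (X i ω - m) / √v := by
    ext ω
    rw [sampleMean, ← Finset.sum_div, Finset.sum_sub_distrib, Finset.sum_const, Finset.card_univ,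
      Fintype.card_fin, nsmul_eq_mul]
    have : (k : ℝ)⁻¹ * (∑ i, X i ω) - m = (k : ℝ)⁻¹ * ((∑ i, X i ω) - k * m) := by field_simp
    rw [this]
    have : √(k : ℝ) * (k : ℝ)⁻¹ = (√(k : ℝ))⁻¹ := by
      nth_rewrite 2 [← hr]
      field_simp
    rw [← this]
    ring
  have hind : iIndepFun (fun i ω => (X i ω - m) / √v) P :=
    hindep.comp (fun _ x => (x - m) / √v) fun _ => hf
  have hmeas : ∀ i, Measurable fun ω => (X i ω - m) / √v := fun i => hf.comp (hX i)
  rw [e, charFun_map_mul_comp (Finset.measurable_fun_sum _ fun i _ => hmeas i).aemeasurable,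
    hind.charFun_map_fun_sum_eq_prod fun i => (hmeas i).aemeasurable]
  have hlaw : ∀ i, P.map (fun ω => (X i ω - m) / √v) = ρ.map fun x => (x - m) / √v := fun i => by
    rw [← hρ i, Measure.map_map hf (hX i)]
    rfl
  simp [hlaw]

/-- The scale v need not be the variance of ρ, only close to it: the bootstrap mean is scaled by the
true variance, while its summands have the empirical one. The probability space is arbitrary, so
that both P and a product of empirical laws can be inserted. -/
lemma exists_kolmogorovDist_standardized_le {ε : ℝ} (hε : 0 < ε) :
    ∃ δ > 0, ∀ {Ω : Type*} [MeasurableSpace Ω] (P : Measure Ω) [IsProbabilityMeasure P] (k : ℕ)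
      (X : Fin k → Ω → ℝ) (ρ : Measure ℝ) (v m : ℝ), 0 < k → (k : ℝ)⁻¹ ≤ δ →
      (∀ i, Measurable (X i)) → iIndepFun X P → (∀ i, P.map (X i) = ρ) → 0 < v →
      ∫ x, x ∂ρ = m → Integrable (fun x => |x| ^ 3) ρ → |(∫ x, (x - m) ^ 2 ∂ρ) - v| ≤ δ * v →
      (√(k : ℝ))⁻¹ * ∫ x, |x - m| ^ 3 ∂ρ ≤ δ * √v ^ 3 →
      kolmogorovDist (P.map fun ω => √(k : ℝ) / √v * (sampleMean (fun i => X i ω) - m))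
        (gaussianReal 0 1) ≤ ε := by
  obtain ⟨δ, hδ, h⟩ := exists_kolmogorovDist_gaussianReal_le hε
  refine ⟨δ, hδ, ?_⟩
  intro Ω _ P _ k X ρ v m hk hkδ hX hindep hρ hv hm h3 hvar hthird
  have hs : 0 < √v := Real.sqrt_pos.2 hv
  have hs2 : √v ^ 2 = v := Real.sq_sqrt hv.le
  have : IsProbabilityMeasure ρ := by
    rw [← hρ ⟨0, hk⟩]
    exact Measure.isProbabilityMeasure_map (hX _).aemeasurable
  have hf : Measurable fun x : ℝ => (x - m) / √v := by fun_prop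
  have : IsProbabilityMeasure (ρ.map fun x => (x - m) / √v) :=
    Measure.isProbabilityMeasure_map hf.aemeasurable
  have : IsProbabilityMeasure
      (P.map fun ω => √(k : ℝ) / √v * (sampleMean (fun i => X i ω) - m)) :=
    Measure.isProbabilityMeasure_map (by fun_prop)
  have i1 : Integrable (fun x : ℝ => x) ρ := by
    simpa using integrable_pow_of_abs_cube h3 (p := 1) (by norm_num)
  refine h k (ρ.map fun x => (x - m) / √v) _ hk hkδ
    (charFun_map_standardized_sampleMean hk hX hindep hρ v m) ?_ ?_ ?_ ?_
  · rw [integral_map hf.aemeasurable (by fun_prop), integral_div, integral_sub i1 (by simp), hm]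
    simp
  · rw [integrable_map_measure (by fun_prop) hf.aemeasurable]
    have : Integrable (fun x => 4 * (|x| ^ 3 + |m| ^ 3) / √v ^ 3) ρ :=
      ((h3.add (integrable_const _)).const_mul 4).div_const _
    refine this.mono' (by fun_prop) (.of_forall fun x => ?_)
    rw [Function.comp_apply, Real.norm_of_nonneg (by positivity), abs_div, div_pow, abs_of_pos hs]
    gcongr
    calc |x - m| ^ 3 ≤ (|x| + |m|) ^ 3 := by gcongr; exact abs_sub x m
      _ ≤ 4 * (|x| ^ 3 + |m| ^ 3) := by
        have := add_pow_le (abs_nonneg x) (abs_nonneg m) 3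
        norm_num at this
        exact this
  · rw [integral_map hf.aemeasurable (by fun_prop)]
    simp only [div_pow, hs2]
    rw [integral_div, div_sub_one hv.ne', abs_div, abs_of_pos hv, div_le_iff₀ hv]
    exact hvar
  · rw [integral_map hf.aemeasurable (by fun_prop)]
    simp only [abs_div, div_pow, abs_of_pos hs]
    rw [integral_div, ← mul_div_assoc, div_le_iff₀ (by positivity)]
    exact hthird

/-! ### Moments of the empirical law -/

lemma isProbabilityMeasure_empiricalLaw {k : ℕ} (hk : 0 < k) (x : Fin k → ℝ) :
    IsProbabilityMeasure (empiricalLaw x) := by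
  refine ⟨?_⟩
  have : (k : ℝ≥0∞) ≠ 0 := by exact_mod_cast hk.ne'
  simp [empiricalLaw, ENNReal.inv_mul_cancel this (ENNReal.natCast_ne_top k)]

lemma integral_empiricalLaw {k : ℕ} (x : Fin k → ℝ) (f : ℝ → ℝ) :
    ∫ y, f y ∂empiricalLaw x = (k : ℝ)⁻¹ * ∑ j, f (x j) := by
  rw [empiricalLaw, integral_smul_measure, integral_finsetSum_measure]
  · simp
  · intro i _
    exact integrable_dirac (by simp)

lemma integrable_empiricalLaw {k : ℕ} (hk : 0 < k) (x : Fin k → ℝ) (f : ℝ → ℝ) :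
    Integrable f (empiricalLaw x) := by
  refine Integrable.smul_measure (integrable_finsetSum_measure.2 fun i _ => ?_) ?_
  · exact integrable_dirac (by simp)
  · simp [hk.ne']

lemma integral_sub_sampleMean_sq_empiricalLaw {k : ℕ} (hk : 0 < k) (x : Fin k → ℝ) :
    ∫ y, (y - sampleMean x) ^ 2 ∂empiricalLaw x =
      (k : ℝ)⁻¹ * (∑ j, x j ^ 2) - sampleMean x ^ 2 := by
  have hk' : (k : ℝ) ≠ 0 := by exact_mod_cast hk.ne'
  have hs : ∑ j, x j = k * sampleMean x := by rw [sampleMean]; field_simp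
  rw [integral_empiricalLaw]
  have : ∀ j, (x j - sampleMean x) ^ 2 =
      x j ^ 2 - 2 * sampleMean x * x j + sampleMean x ^ 2 := fun j => by ring
  simp only [this, Finset.sum_add_distrib, Finset.sum_sub_distrib, ← Finset.mul_sum, hs,
    Finset.sum_const, Finset.card_univ, Fintype.card_fin, nsmul_eq_mul]
  field_simp
  ring

/-- Convexity gives |a - b|³ ≤ 4(|a|³ + |b|³), and Jensen's inequality bounds the cubed mean by the
third absolute moment, whence 8 = 4 + 4. -/
lemma integral_abs_sub_sampleMean_cube_empiricalLaw_le {k : ℕ} (hk : 0 < k) (x : Fin k → ℝ) :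
    ∫ y, |y - sampleMean x| ^ 3 ∂empiricalLaw x ≤ 8 * ((k : ℝ)⁻¹ * ∑ j, |x j| ^ 3) := by
  have hk' : (k : ℝ) ≠ 0 := by exact_mod_cast hk.ne'
  have hm : |sampleMean x| ^ 3 ≤ (k : ℝ)⁻¹ * ∑ j, |x j| ^ 3 := by
    have h1 : |sampleMean x| ≤ ∑ j, (k : ℝ)⁻¹ * |x j| := by
      rw [sampleMean, abs_mul, abs_of_nonneg (by positivity : (0 : ℝ) ≤ (k : ℝ)⁻¹),
        ← Finset.mul_sum]
      gcongr
      exact Finset.abs_sum_le_sum_abs _ _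
    refine (pow_le_pow_left₀ (abs_nonneg _) h1 3).trans ?_
    rw [Finset.mul_sum]
    refine Real.pow_arith_mean_le_arith_mean_pow Finset.univ (fun _ => (k : ℝ)⁻¹) (fun j => |x j|)
      (fun _ _ => by positivity) ?_ (fun _ _ => abs_nonneg _) 3
    simp [hk']
  rw [integral_empiricalLaw]
  calc (k : ℝ)⁻¹ * ∑ j, |x j - sampleMean x| ^ 3
      ≤ (k : ℝ)⁻¹ * ∑ j, 4 * (|x j| ^ 3 + |sampleMean x| ^ 3) := by
        gcongr with j
        refine (pow_le_pow_left₀ (abs_nonneg _) (abs_sub _ _) 3).trans ?_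
        have := add_pow_le (abs_nonneg (x j)) (abs_nonneg (sampleMean x)) 3
        norm_num at this
        exact this
    _ = 4 * ((k : ℝ)⁻¹ * ∑ j, |x j| ^ 3) + 4 * |sampleMean x| ^ 3 := by
        rw [← Finset.mul_sum, Finset.sum_add_distrib, Finset.sum_const, Finset.card_univ,
          Fintype.card_fin, nsmul_eq_mul]
        field_simp
    _ ≤ _ := by linarith

/-! ### Expected fluctuation of the sample -/

lemma variance_sampleMean {Ω : Type*} [MeasurableSpace Ω] {P : Measure Ω} [IsProbabilityMeasure P]
    {k : ℕ} (hk : 0 < k) {X : Fin k → Ω → ℝ} (hX : ∀ i, MemLp (X i) 2 P) (hindep : iIndepFun X P)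
    {w : ℝ} (hw : ∀ i, variance (X i) P = w) :
    variance (fun ω => sampleMean fun i => X i ω) P = w / k := by
  have hk' : (k : ℝ) ≠ 0 := by exact_mod_cast hk.ne'
  have e : (fun ω => sampleMean fun i => X i ω) = fun ω => (k : ℝ)⁻¹ * (∑ i, X i) ω := by
    ext ω
    simp [sampleMean]
  rw [e, variance_const_mul, IndepFun.variance_sum (fun i _ => hX i)
    fun i _ j _ hij => hindep.indepFun hij]
  simp only [hw, Finset.sum_const, Finset.card_univ, Fintype.card_fin, nsmul_eq_mul]
  field_simp

lemma integral_sampleMean {Ω : Type*} [MeasurableSpace Ω] {P : Measure Ω}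
    {k : ℕ} (hk : 0 < k) {X : Fin k → Ω → ℝ} (hX : ∀ i, Integrable (X i) P)
    {m : ℝ} (hm : ∀ i, ∫ ω, X i ω ∂P = m) :
    ∫ ω, (sampleMean fun i => X i ω) ∂P = m := by
  have hk' : (k : ℝ) ≠ 0 := by exact_mod_cast hk.ne'
  simp only [sampleMean]
  rw [integral_const_mul, integral_finsetSum _ fun i _ => hX i]
  simp [hm, hk']

lemma memLp_sampleMean {Ω : Type*} [MeasurableSpace Ω] {P : Measure Ω} {p : ℝ≥0∞}
    {k : ℕ} {X : Fin k → Ω → ℝ} (hX : ∀ i, MemLp (X i) p P) :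
    MemLp (fun ω => sampleMean fun i => X i ω) p P :=
  (memLp_finsetSum Finset.univ fun i _ => hX i).const_mul _

/-- The size of the fluctuations of a centered sample that govern the bootstrap: the deviation of
the second sample moment from `v`, the sample mean, and the Lyapunov ratio. -/
noncomputable def sampleFluctuation {k : ℕ} (v : ℝ) (x : Fin k → ℝ) : ℝ :=
  ((sampleMean fun i => x i ^ 2) - v) ^ 2 + sampleMean x ^ 2 +
    (√(k : ℝ))⁻¹ * sampleMean fun i => |x i| ^ 3

lemma sampleFluctuation_nonneg {k : ℕ} (v : ℝ) (x : Fin k → ℝ) : 0 ≤ sampleFluctuation v x := by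
  unfold sampleFluctuation sampleMean
  positivity

lemma abs_cube_le_one_add_pow_four (x : ℝ) : |x| ^ 3 ≤ 1 + x ^ 4 := by
  have h : x ^ 4 = |x| ^ 4 := by rw [pow_abs, abs_of_nonneg (by positivity)]
  have h0 := abs_nonneg x
  rw [h]
  nlinarith [sq_nonneg (|x| ^ 2 - |x|), sq_nonneg (|x| - 1), sq_nonneg (|x| ^ 2 - 1)]

lemma sq_le_one_add_pow_four (x : ℝ) : x ^ 2 ≤ 1 + x ^ 4 := by nlinarith [sq_nonneg (x ^ 2 - 1)]

lemma integrable_abs_cube_of_pow_four {Ω : Type*} [MeasurableSpace Ω] {P : Measure Ω}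
    [IsFiniteMeasure P] {X : Ω → ℝ} (hX : Measurable X) (h4 : Integrable (fun ω => X ω ^ 4) P) :
    Integrable (fun ω => |X ω| ^ 3) P :=
  ((integrable_const (1 : ℝ)).add h4).mono' (by fun_prop) (.of_forall fun ω => by
    rw [Real.norm_of_nonneg (by positivity)]
    exact abs_cube_le_one_add_pow_four _)

lemma integral_abs_cube_le {Ω : Type*} [MeasurableSpace Ω] {P : Measure Ω}
    [IsProbabilityMeasure P] {X : Ω → ℝ} (hX : Measurable X)
    (h4 : Integrable (fun ω => X ω ^ 4) P) :
    ∫ ω, |X ω| ^ 3 ∂P ≤ 1 + ∫ ω, X ω ^ 4 ∂P := by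
  calc ∫ ω, |X ω| ^ 3 ∂P ≤ ∫ ω, (1 + X ω ^ 4) ∂P :=
        integral_mono (integrable_abs_cube_of_pow_four hX h4) ((integrable_const _).add h4)
          fun ω => abs_cube_le_one_add_pow_four _
    _ = 1 + ∫ ω, X ω ^ 4 ∂P := by
        rw [integral_add (integrable_const _) h4]
        simp

/-- The first two summands have expectation Var(X²)/k and Var(X)/k, the third E|X|³/√k. All three
numerators are at most 1 + M, and 1/k ≤ 1/√k gives a common rate. -/
lemma integrable_and_integral_sampleFluctuation_le {Ω : Type*} [MeasurableSpace Ω] {P : Measure Ω}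
    [IsProbabilityMeasure P] {k : ℕ} (hk : 0 < k) {X : Fin k → Ω → ℝ}
    (hX : ∀ i, Measurable (X i)) (hindep : iIndepFun X P)
    (hident : ∀ i j, IdentDistrib (X i) (X j) P P) (hmean : ∀ i, ∫ ω, X i ω ∂P = 0)
    {M : ℝ} (h4 : ∀ i, Integrable (fun ω => X i ω ^ 4) P) (hM : ∀ i, ∫ ω, X i ω ^ 4 ∂P ≤ M) :
    Integrable (fun ω => sampleFluctuation (variance (X ⟨0, hk⟩) P) fun i => X i ω) P ∧
      ∫ ω, sampleFluctuation (variance (X ⟨0, hk⟩) P) (fun i => X i ω) ∂P ≤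
        3 * (1 + M) * (√(k : ℝ))⁻¹ := by
  set v := variance (X ⟨0, hk⟩) P with hv
  have hk' : (0 : ℝ) < k := by exact_mod_cast hk
  have hk1 : (1 : ℝ) ≤ k := by exact_mod_cast hk
  have hinv : (k : ℝ)⁻¹ ≤ (√(k : ℝ))⁻¹ := by
    gcongr
    exact Real.sqrt_le_iff.2 ⟨by positivity, by nlinarith⟩
  have L4 : ∀ i, MemLp (fun ω => X i ω ^ 2) 2 P := fun i => by
    rw [memLp_two_iff_integrable_sq (by fun_prop)]
    simpa [← pow_mul] using h4 i
  have I2 : ∀ i, Integrable (fun ω => X i ω ^ 2) P := fun i => (L4 i).integrable (by norm_num)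
  have L2 : ∀ i, MemLp (X i) 2 P := fun i =>
    (memLp_two_iff_integrable_sq (hX i).aestronglyMeasurable).2 (I2 i)
  have I3 : ∀ i, Integrable (fun ω => |X i ω| ^ 3) P := fun i =>
    integrable_abs_cube_of_pow_four (hX i) (h4 i)
  have hX2 : ∀ i, ∫ ω, X i ω ^ 2 ∂P = v := fun i => by
    rw [hv, (hident ⟨0, hk⟩ i).variance_eq,
      variance_of_integral_eq_zero (hX i).aemeasurable (hmean i)]
  have hX3 : ∀ i, ∫ ω, |X i ω| ^ 3 ∂P ≤ 1 + M := fun i =>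
    (integral_abs_cube_le (hX i) (h4 i)).trans (by linarith [hM i])
  have hvM : v ≤ 1 + M := by
    rw [← hX2 ⟨0, hk⟩]
    calc ∫ ω, X ⟨0, hk⟩ ω ^ 2 ∂P ≤ ∫ ω, (1 + X ⟨0, hk⟩ ω ^ 4) ∂P :=
          integral_mono (I2 _) ((integrable_const _).add (h4 _)) fun ω => sq_le_one_add_pow_four _
      _ ≤ 1 + M := by
          rw [integral_add (integrable_const _) (h4 _)]
          simpa using hM _
  have hM0 : 0 ≤ M := (integral_nonneg fun ω => by positivity).trans (hM ⟨0, hk⟩)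
  have S2L := memLp_sampleMean L4
  have S1L := memLp_sampleMean L2
  have J1 : Integrable (fun ω => ((sampleMean fun i => X i ω ^ 2) - v) ^ 2) P :=
    (S2L.sub (memLp_const v)).integrable_sq
  have J2 : Integrable (fun ω => (sampleMean fun i => X i ω) ^ 2) P := S1L.integrable_sq
  have J3' : Integrable (fun ω => sampleMean fun i => |X i ω| ^ 3) P :=
    (integrable_finsetSum _ fun i _ => I3 i).const_mul _
  have J3 : Integrable (fun ω => (√(k : ℝ))⁻¹ * sampleMean fun i => |X i ω| ^ 3) P :=
    J3'.const_mul _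
  have J12 : Integrable (fun ω => ((sampleMean fun i => X i ω ^ 2) - v) ^ 2 +
      (sampleMean fun i => X i ω) ^ 2) P := J1.add J2
  refine ⟨J12.add J3, ?_⟩
  have hind2 : iIndepFun (fun i ω => X i ω ^ 2) P :=
    hindep.comp (fun _ x => x ^ 2) fun _ => by fun_prop
  have E1 : ∫ ω, ((sampleMean fun i => X i ω ^ 2) - v) ^ 2 ∂P ≤ (1 + M) * (√(k : ℝ))⁻¹ := by
    have h1 := integral_sampleMean hk I2 hX2
    have h2 := variance_sampleMean hk L4 hind2 (w := variance (fun ω => X ⟨0, hk⟩ ω ^ 2) P)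
      fun i => ((hident i ⟨0, hk⟩).comp (u := fun x => x ^ 2) (by fun_prop)).variance_eq
    rw [variance_eq_integral S2L.aestronglyMeasurable.aemeasurable, h1] at h2
    rw [h2, div_eq_mul_inv]
    have h3 : variance (fun ω => X ⟨0, hk⟩ ω ^ 2) P ≤ M := by
      refine (variance_le_expectation_sq (L4 _).aestronglyMeasurable).trans ?_
      simpa [← pow_mul] using hM ⟨0, hk⟩
    gcongr
    linarith
  have E2 : ∫ ω, (sampleMean fun i => X i ω) ^ 2 ∂P ≤ (1 + M) * (√(k : ℝ))⁻¹ := by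
    have h1 := integral_sampleMean hk (fun i => (L2 i).integrable (by norm_num)) hmean
    have h2 := variance_sampleMean hk L2 hindep (w := v) fun i => (hident i _).variance_eq
    rw [variance_of_integral_eq_zero S1L.aestronglyMeasurable.aemeasurable h1] at h2
    rw [h2, div_eq_mul_inv]
    gcongr
  have E3 : ∫ ω, (√(k : ℝ))⁻¹ * (sampleMean fun i => |X i ω| ^ 3) ∂P ≤
      (1 + M) * (√(k : ℝ))⁻¹ := by
    have h1 := integral_sampleMean hk I3 (m := ∫ ω, |X ⟨0, hk⟩ ω| ^ 3 ∂P)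
      fun i => ((hident i ⟨0, hk⟩).comp (u := fun x => |x| ^ 3) (by fun_prop)).integral_eq
    rw [integral_const_mul, h1, mul_comm]
    gcongr
    exact hX3 _
  have : ∫ ω, sampleFluctuation v (fun i => X i ω) ∂P =
      (∫ ω, ((sampleMean fun i => X i ω ^ 2) - v) ^ 2 ∂P) +
        (∫ ω, (sampleMean fun i => X i ω) ^ 2 ∂P) +
        ∫ ω, (√(k : ℝ))⁻¹ * (sampleMean fun i => |X i ω| ^ 3) ∂P := by
    rw [← integral_add J1 J2, ← integral_add J12 J3]
    rfl
  rw [this]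
  linarith

/-! ### The bootstrap law given the sample -/

/-- For a fixed sample, the coordinates on the product of empirical laws are independent and
identically distributed with mean `sampleMean x`, so the uniform central limit theorem applies. -/
lemma exists_kolmogorovDist_bootstrap_le {ε c : ℝ} (hε : 0 < ε) (hc : 0 < c) :
    ∃ δ > 0, ∃ a > 0, ∀ (k : ℕ) (x : Fin k → ℝ) (v : ℝ), 0 < k → (k : ℝ)⁻¹ ≤ δ → c ≤ v →
      sampleFluctuation v x < a →
      kolmogorovDist ((Measure.pi fun _ : Fin k => empiricalLaw x).map fun y =>
        √(k : ℝ) / √v * (sampleMean y - sampleMean x)) (gaussianReal 0 1) ≤ ε := by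
  obtain ⟨δ, hδ, h⟩ := exists_kolmogorovDist_standardized_le hε
  have hsc : 0 < √c := Real.sqrt_pos.2 hc
  -- The empirical variance is the second sample moment minus the squared mean; the first two
  -- thresholds allot δc/2 to the error of each. The third absorbs the factor 8 from centering in
  -- the Lyapunov ratio.
  refine ⟨δ, hδ, min ((δ * c / 2) ^ 2) (min (δ * c / 2) (δ * √c ^ 3 / 8)), by positivity, ?_⟩
  intro k x v hk hkδ hcv hF
  have := isProbabilityMeasure_empiricalLaw hk x
  rw [lt_min_iff, lt_min_iff, sampleFluctuation] at hF
  obtain ⟨F1, F2, F3⟩ := hF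
  have n1 := sq_nonneg ((sampleMean fun i => x i ^ 2) - v)
  have n2 := sq_nonneg (sampleMean x)
  have n3 : 0 ≤ (√(k : ℝ))⁻¹ * sampleMean fun i => |x i| ^ 3 := by
    unfold sampleMean
    positivity
  have b1 : |(sampleMean fun i => x i ^ 2) - v| ≤ δ * c / 2 :=
    abs_le_of_sq_le_sq (by linarith) (by positivity)
  refine h (Measure.pi fun _ : Fin k => empiricalLaw x) k (fun i y => y i) (empiricalLaw x) v
    (sampleMean x) hk hkδ (fun i => measurable_pi_apply i) ?_ ?_ (hc.trans_le hcv) ?_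
    (integrable_empiricalLaw hk x _) ?_ ?_
  · exact iIndepFun_pi (X := fun _ y => y) fun i => aemeasurable_id
  · intro i
    exact (measurePreserving_eval (fun _ : Fin k => empiricalLaw x) i).map_eq
  · exact integral_empiricalLaw x _
  · rw [integral_sub_sampleMean_sq_empiricalLaw hk]
    have : δ * c ≤ δ * v := by gcongr
    change |(sampleMean fun i => x i ^ 2) - sampleMean x ^ 2 - v| ≤ δ * v
    rw [abs_le] at b1 ⊢
    constructor <;> linarith
  · calc (√(k : ℝ))⁻¹ * ∫ y, |y - sampleMean x| ^ 3 ∂empiricalLaw x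
        ≤ (√(k : ℝ))⁻¹ * (8 * sampleMean fun i => |x i| ^ 3) := by
          gcongr
          exact integral_abs_sub_sampleMean_cube_empiricalLaw_le hk x
      _ ≤ δ * √c ^ 3 := by linarith
      _ ≤ δ * √v ^ 3 := by gcongr

lemma condDistrib_standardizedBootstrapMean_ae_eq {Ω : Type*} [MeasurableSpace Ω] {P : Measure Ω}
    [IsFiniteMeasure P] {k : ℕ} {ξ ξs : Fin k → Ω → ℝ} (hξ : ∀ i, Measurable (ξ i))
    (hξs : IsBootstrapVersion P ξ ξs) (v : ℝ) :
    ∀ᵐ ω ∂P, condDistrib (standardizedBootstrapMean ξ ξs v) (fun ω' i => ξ i ω') P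
        (fun i => ξ i ω) =
      (Measure.pi fun _ : Fin k => empiricalLaw fun j => ξ j ω).map fun y =>
        √(k : ℝ) / √v * (sampleMean y - sampleMean fun i => ξ i ω) := by
  have h := condDistrib_comp_prodMk_ae_eq (μ := P) (X := fun ω i => ξ i ω) (Y := fun ω i => ξs i ω)
    (f := fun x y => √(k : ℝ) / √v * (sampleMean y - sampleMean x))
    (measurable_pi_lambda _ hξ) (measurable_pi_lambda _ hξs.measurable)
    (by unfold Function.uncurry; fun_prop)
  filter_upwards [h, hξs.condDistrib_eq] with ω h1 h2
  rw [h2] at h1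
  exact h1

lemma integrable_of_lintegral_ofReal_lt_top {Ω : Type*} [MeasurableSpace Ω] {P : Measure Ω}
    {f : Ω → ℝ} (hf : Measurable f) (hf0 : ∀ ω, 0 ≤ f ω)
    (h : ∫⁻ ω, ENNReal.ofReal (f ω) ∂P < ⊤) : Integrable f P :=
  ⟨hf.aestronglyMeasurable, (hasFiniteIntegral_iff_ofReal (.of_forall hf0)).2 h⟩

/-! ### Convergence in probability -/

theorem theoremA1 {Ω : Type*} [MeasurableSpace Ω] (P : Measure Ω) [IsProbabilityMeasure P]
    (k : ℕ → ℕ) (hk : ∀ n, 0 < k n) (hk_lim : Tendsto k atTop atTop)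
    (ξ : (n : ℕ) → Fin (k n) → Ω → ℝ)
    (hξ_meas : ∀ n i, Measurable (ξ n i))
    (hξ_indep : ∀ n, iIndepFun (ξ n) P)
    (hξ_ident : ∀ n i j, IdentDistrib (ξ n i) (ξ n j) P P)
    (hξ_mean : ∀ n i, ∫ ω, ξ n i ω ∂P = 0)
    (hξ_moment : (⨆ n, ∫⁻ ω, ENNReal.ofReal (ξ n ⟨0, hk n⟩ ω ^ 4) ∂P) < ⊤)
    (hξ_var : 0 < liminf (fun n => variance (ξ n ⟨0, hk n⟩) P) atTop)
    (ξs : (n : ℕ) → Fin (k n) → Ω → ℝ)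
    (hξs : ∀ n, IsBootstrapVersion P (ξ n) (ξs n)) :
    TendstoInMeasure P
      (fun n ω => kolmogorovDist
        (condDistrib (standardizedBootstrapMean (ξ n) (ξs n) (variance (ξ n ⟨0, hk n⟩) P))
          (fun ω' i => ξ n i ω') P (fun i => ξ n i ω))
        (P.map (standardizedMean (ξ n) (variance (ξ n ⟨0, hk n⟩) P))))
      atTop (fun _ => 0) := by
  set M : ℝ := (⨆ n, ∫⁻ ω, ENNReal.ofReal (ξ n ⟨0, hk n⟩ ω ^ 4) ∂P).toReal with hM
  set v : ℕ → ℝ := fun n => variance (ξ n ⟨0, hk n⟩) P with hv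
  have hle : ∀ n, ∫⁻ ω, ENNReal.ofReal (ξ n ⟨0, hk n⟩ ω ^ 4) ∂P ≤
      ⨆ n, ∫⁻ ω, ENNReal.ofReal (ξ n ⟨0, hk n⟩ ω ^ 4) ∂P := fun n => le_iSup_iff.2 fun _ h => h n
  have hident4 : ∀ n i, IdentDistrib (fun ω => ξ n i ω ^ 4) (fun ω => ξ n ⟨0, hk n⟩ ω ^ 4) P P :=
    fun n i => (hξ_ident n i _).comp (u := fun x => x ^ 4) (by fun_prop)
  have h4 : ∀ n i, Integrable (fun ω => ξ n i ω ^ 4) P := fun n i =>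
    (hident4 n i).integrable_iff.2 (integrable_of_lintegral_ofReal_lt_top
      ((hξ_meas n _).pow_const 4) (fun ω => by positivity) ((hle n).trans_lt hξ_moment))
  have hM4 : ∀ n i, ∫ ω, ξ n i ω ^ 4 ∂P ≤ M := fun n i => by
    rw [(hident4 n i).integral_eq, integral_eq_lintegral_of_nonneg_ae
      (.of_forall fun ω => by positivity) ((hξ_meas n _).pow_const 4).aestronglyMeasurable]
    exact ENNReal.toReal_mono hξ_moment.ne (hle n)
  have hsqrt : Tendsto (fun n => (√(k n : ℝ))⁻¹) atTop (𝓝 0) :=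
    tendsto_inv_atTop_zero.comp <| Real.tendsto_sqrt_atTop.comp <|
      tendsto_natCast_atTop_atTop.comp hk_lim
  have hinv : Tendsto (fun n => (k n : ℝ)⁻¹) atTop (𝓝 0) :=
    tendsto_inv_atTop_zero.comp <| tendsto_natCast_atTop_atTop.comp hk_lim
  -- A fixed lower bound for the variances, valid for all large n, keeps the thresholds independent
  -- of n.
  obtain ⟨c, hc, hcv⟩ := exists_between hξ_var
  have hvc : ∀ᶠ n in atTop, c < v n := eventually_lt_of_lt_liminf hcv
    (isBoundedUnder_of ⟨0, fun n => variance_nonneg _ _⟩)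
  have hsc : 0 < √c := Real.sqrt_pos.2 hc
  rw [tendstoInMeasure_iff_measureReal_norm]
  intro ε hε
  obtain ⟨δ₁, hδ₁, hsample⟩ := exists_kolmogorovDist_standardized_le (show 0 < ε / 3 by positivity)
  obtain ⟨δ₂, hδ₂, a, ha, hboot⟩ :=
    exists_kolmogorovDist_bootstrap_le (show 0 < ε / 3 by positivity) hc
  have hbound : Tendsto (fun n => a⁻¹ * (3 * (1 + M) * (√(k n : ℝ))⁻¹)) atTop (𝓝 0) := by
    simpa using (hsqrt.const_mul (3 * (1 + M))).const_mul a⁻¹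
  refine squeeze_zero' (.of_forall fun _ => measureReal_nonneg) ?_ hbound
  have hthird : ∀ᶠ n in atTop, (1 + M) * (√(k n : ℝ))⁻¹ < δ₁ * √c ^ 3 := by
    have : Tendsto (fun n => (1 + M) * (√(k n : ℝ))⁻¹) atTop (𝓝 0) := by
      simpa using hsqrt.const_mul (1 + M)
    exact this.eventually_lt_const (by positivity)
  filter_upwards [hvc, hinv.eventually_lt_const hδ₁, hinv.eventually_lt_const hδ₂, hthird]
    with n hn hn1 hn2 hn3
  have hvn : 0 < v n := hc.trans hn
  have hF := integrable_and_integral_sampleFluctuation_le (hk n) (hξ_meas n) (hξ_indep n)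
    (hξ_ident n) (hξ_mean n) (h4 n) (hM4 n)
  set F : Ω → ℝ := fun ω => sampleFluctuation (v n) fun i => ξ n i ω with hFdef
  have hmarkov : P.real {ω | a ≤ F ω} ≤ a⁻¹ * (3 * (1 + M) * (√(k n : ℝ))⁻¹) := by
    have := mul_meas_ge_le_integral_of_nonneg
      (.of_forall fun ω => sampleFluctuation_nonneg (v n) fun i => ξ n i ω) hF.1 a
    rw [le_inv_mul_iff₀ ha]
    exact this.trans hF.2
  refine le_trans ?_ hmarkov
  have hlaw : kolmogorovDist (P.map (standardizedMean (ξ n) (v n))) (gaussianReal 0 1) ≤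
      ε / 3 := by
    set i₀ : Fin (k n) := ⟨0, hk n⟩
    have hi₀ := hξ_meas n i₀
    -- For the row itself the scale is the exact variance, so the variance error is zero and only
    -- the Lyapunov ratio matters.
    have := hsample P (k n) (ξ n) (P.map (ξ n i₀)) (v n) 0 (hk n) hn1.le (hξ_meas n) (hξ_indep n)
      (fun i => (hξ_ident n i i₀).map_eq) hvn ?_ ?_ ?_ ?_
    · simp only [sub_zero] at this
      exact this
    · rw [integral_map hi₀.aemeasurable (by fun_prop), hξ_mean]
    · rw [integrable_map_measure (by fun_prop) hi₀.aemeasurable]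
      exact integrable_abs_cube_of_pow_four hi₀ (h4 n i₀)
    · rw [integral_map hi₀.aemeasurable (by fun_prop)]
      simp only [sub_zero]
      rw [← variance_of_integral_eq_zero hi₀.aemeasurable (hξ_mean n i₀), sub_self, abs_zero]
      positivity
    · rw [integral_map hi₀.aemeasurable (by fun_prop)]
      simp only [sub_zero]
      calc (√(k n : ℝ))⁻¹ * ∫ ω, |ξ n i₀ ω| ^ 3 ∂P ≤ (√(k n : ℝ))⁻¹ * (1 + M) := by
            gcongr
            exact (integral_abs_cube_le hi₀ (h4 n i₀)).trans (by linarith [hM4 n i₀])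
        _ ≤ δ₁ * √c ^ 3 := by linarith
        _ ≤ δ₁ * √(v n) ^ 3 := by gcongr
  have hmeas : Measurable (standardizedMean (ξ n) (v n)) := by
    have := hξ_meas n
    unfold standardizedMean
    fun_prop
  have : IsProbabilityMeasure (P.map (standardizedMean (ξ n) (v n))) :=
    Measure.isProbabilityMeasure_map hmeas.aemeasurable
  -- An almost sure inclusion of events suffices; measurability of the Kolmogorov distance in ω is
  -- never needed.
  refine ENNReal.toReal_mono (measure_ne_top _ _) (measure_mono_ae ?_)
  filter_upwards [condDistrib_standardizedBootstrapMean_ae_eq (hξ_meas n) (hξs n) (v n)]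
    with ω hω hdist
  change ε ≤ ‖_ - (0 : ℝ)‖ at hdist
  rw [sub_zero, Real.norm_of_nonneg (kolmogorovDist_nonneg _ _)] at hdist
  change a ≤ F ω
  -- Below the threshold both laws are within ε/3 of the normal law, so their distance is at most
  -- 2ε/3 < ε.
  by_contra! hlt
  have hb := hboot (k n) (fun i => ξ n i ω) (v n) (hk n) hn2.le hn.le hlt
  rw [← hω] at hb
  have htri := kolmogorovDist_triangle
    (condDistrib (standardizedBootstrapMean (ξ n) (ξs n) (v n)) (fun ω' i => ξ n i ω') P
      (fun i => ξ n i ω)) (gaussianReal 0 1) (P.map (standardizedMean (ξ n) (v n)))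
  rw [kolmogorovDist_comm (gaussianReal 0 1)] at htri
  linarith
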